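/- \textbf{The spaces.} Let $\Delta_1$ be a one-point set and, inductively, $\Gamma_n=\bigcup_{k=1}^n\Delta_k$ and $$\Delta_{n+1}=\{n+1\}\times\bigcup_{1\le k<n}\{k\}\times\Gamma_k\times\Gamma_n\times\{\pm1\}\times\{\pm1\},\qquad \Gamma=\bigcup_n\Gamma_n .$$ An element of $\Delta_n$ is said to have rank $n$. Let $a,b$ be real numbers with either $a=1$, $0<b<\frac12$ (class $\mathcal X$), or $0<b<\frac12<a<1$, $a+b>1$ (class $\mathcal Y$). Define linear maps $i_{k,n}:\ell_\infty(\Gamma_k)\to\ell_\infty(\Gamma_n)$ ($k\le n$) by $i_{n,n}=\mathrm{id}$, $i_{k,n+1}=i_n\circ i_{k,n}$, where $i_n=i_{n,n+1}$ is given by $i_nx(\gamma)=x(\gamma)$ for $\gamma\in\Gamma_n$ and $$i_nx(n+1,k,\xi,\eta,\varepsilon,\varepsilon')=\varepsilon a\,x(\xi)+\varepsilon' b\,[x(\eta)-(i_{k,n}(x|_{\Gamma_k}))(\eta)].$$ Let $(j_mx)(\delta)=(i_{m,n}x)(\delta)$ for $\delta\in\Gamma_n$, $n\ge m$, and let $X=X_{a,b}$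 be the closure of $\bigcup_m \mathrm{im}\, j_m$ in $\ell_\infty(\Gamma)$. Let $(e^*_\gamma)$ be the unit vectors of $\ell_1(\Gamma)$, and put $c^*_\gamma=i_n^*e^*_\gamma\in\ell_1(\Gamma_n)$ for $\gamma\in\Delta_{n+1}$ ($n\ge2$), $c^*_\gamma=0$ for $\gamma\in\Gamma_1$, and $d_\gamma^*=e_\gamma^*-c_\gamma^*$. Let $\lambda$ be either the constant of the construction, that is $\lambda=\frac{a}{1-2b}$ in class $\mathcal Y$ and any $\lambda>1$ with $1+2b\lambda\le\lambda$ in class $\mathcal X$, or the basis constant of the basis $(d^*_\gamma)_{\gamma\in\Gamma}$ of $\ell_1(\Gamma)$ with respect to an enumeration of $\Gamma$ of non-decreasing rank. \textbf{Basic operators.} For $\gamma=(n+1,k,\xi,\eta,\varepsilon,\varepsilon')\in\Delta_{n+1}$, $n\ge 2$, let $\tilde\gamma=(n+1,k,\xi,\eta,-\varepsilon,-\varepsilon')$. Let $F=F_\gamma:\Gamma\to\Gamma$ be the rank preserving map that interchanges $\gamma$ and $\tilde\gamma$, fixes all other elements of $\Gamma_{n+1}$, and for $m>n$ satisfies $$F(m+1,l,\theta,\varphi,\epsilon,\epsilon')=\begin{cases}(m+1,l,F(\theta),\varphi,\sigma_\theta\epsilon,\epsilon')&\varphi\in\Gamma_l\\(m+1,l,F(\theta),F(\varphi),\sigma_\theta\epsilon,\sigma_\varphi\epsilon')&\varphi\in\Gamma_m\setminus\Gamma_l,\end{cases}$$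 where $\sigma_\tau=-1$ if $\tau\in\{\gamma,\tilde\gamma\}$ and $\sigma_\tau=1$ otherwise. Then there is a unique bounded operator $S^*_\gamma$ on $\ell_1(\Gamma)$ with $S_\gamma^*d^*_\tau=\sigma_\tau d^*_{F(\tau)}$ for all $\tau\in\Gamma$. \textbf{Theorem.} Fix $\gamma_n\in\Delta_{n+1}$ for every $n\ge2$ and put $S_n^*=S_{\gamma_n}^*$. (1) For every strictly increasing sequence $(n_j)_{j\ge1}$ of natural numbers with $n_1\ge2$, the limit $T^*_{(n_j)}x^*=\lim_{m\to\infty}S_{n_m}^*\cdots S_{n_1}^*x^*$ exists in norm for every $x^*\in\ell_1(\Gamma)$ and defines a bounded operator on $\ell_1(\Gamma)$, and the dual operator of $T^*_{(n_j)}$ on $\ell_\infty(\Gamma)=\ell_1(\Gamma)^*$ restricts to an isometry $T_{(n_j)}$ of $X$ onto $X$. (2) If $(n_j)\neq(\tilde n_j)$ are two such sequences with $n_1=\tilde n_1$ and $n_2=\tilde n_2$, then $\|T_{(n_j)}-T_{(\tilde n_j)}\|\ge\frac1{2\lambda}$. (3) For $2\le p<q$ there are uncountably many strictly increasing sequences of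 natural numbers with $n_1=p$, $n_2=q$. Consequently $\mathcal L(X)$, the space of bounded operators on $X$ with the operator norm, is non-separable. -/

import Mathlib

namespace BD

/-- The sets `Δ_r` of the Bourgain-Delbaen construction. `Δ_1` has exactly one element, and
`Δ_{n+1}` consists of the tuples `(n+1, k, ξ, η, ε, ε')` with `1 ≤ k < n`, `ξ ∈ Γ_k`, `η ∈ Γ_n`
and signs `ε, ε' ∈ {1, -1}`, where `Γ_m = Δ_1 ∪ ⋯ ∪ Δ_m`; here `p` and `q` are the ranks of
`ξ` and `η`. (`Δ_0` and `Δ_2` are empty.) -/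
inductive Delta : ℕ → Type
  | base : Delta 1
  | node {n k p q : ℕ} (hk : 1 ≤ k) (hkn : k < n) (hp : p ≤ k) (hq : q ≤ n)
      (ξ : Delta p) (η : Delta q) (ε ε' : ℤˣ) : Delta (n + 1)

/-- `Γ = ⋃ Δ_n`. -/
abbrev Gam : Type := Σ n : ℕ, Delta n

/-- The rank of `γ ∈ Γ`: the `n` with `γ ∈ Δ_n`. -/
abbrev rank (γ : Gam) : ℕ := γ.1

/-- `Γ_n = Δ_1 ∪ ⋯ ∪ Δ_n`. -/
abbrev GamLE (n : ℕ) : Type := {γ : Gam // rank γ ≤ n}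

theorem finite_gamLE (n : ℕ) : Finite (GamLE n) := by
  induction n with
  | zero =>
    have : IsEmpty (GamLE 0) := ⟨by
      rintro ⟨⟨r, τ⟩, h⟩
      cases τ <;> simp [rank] at h⟩
    infer_instance
  | succ n ih =>
    let g : (GamLE n ⊕ Unit) ⊕ (Fin n × GamLE n × GamLE n × ℤˣ × ℤˣ) → Option Gam := fun s =>
      match s with
      | Sum.inl (Sum.inl γ) => some γ.1
      | Sum.inl (Sum.inr _) => some ⟨1, Delta.base⟩
      | Sum.inr (k, ξ, η, ε, ε') =>
        if h : 1 ≤ (k : ℕ) ∧ rank ξ.1 ≤ k then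
          some ⟨n + 1, Delta.node h.1 k.2 h.2 η.2 ξ.1.2 η.1.2 ε ε'⟩
        else none
    have hfin : (Set.range g).Finite := Set.finite_range g
    have hpre : ((some : Gam → Option Gam) ⁻¹' Set.range g).Finite :=
      hfin.preimage (Option.some_injective _).injOn
    refine (hpre.subset ?_ : {γ : Gam | rank γ ≤ n + 1}.Finite)
    rintro ⟨r, τ⟩ h
    by_cases hr : r ≤ n
    · exact ⟨Sum.inl (Sum.inl ⟨⟨r, τ⟩, hr⟩), rfl⟩
    · cases τ with
      | base => exact ⟨Sum.inl (Sum.inr ()), rfl⟩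
      | @node m k p q hk hkn hp hq ξ η ε ε' =>
        have hmn : m = n := by
          have h' : m + 1 ≤ n + 1 := h
          omega
        subst hmn
        refine ⟨Sum.inr (⟨k, hkn⟩, ⟨⟨p, ξ⟩, le_trans hp hkn.le⟩, ⟨⟨q, η⟩, hq⟩, ε, ε'), ?_⟩
        simp [g, hk, hp, rank]

noncomputable instance instFintypeGamLE (n : ℕ) : Fintype (GamLE n) :=
  @Fintype.ofFinite _ (finite_gamLE n)

/-- The formula
`(u_n y)(n+1, k, ξ, η, ε, ε') = ε a y(ξ) + ε' b [y(η) - (i_{k,n} π_k y)(η)]`,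
where `i k` stands for `i_{k,n}` and `π_k` is restriction to `Γ_k`. It is used for tuples of rank
`n + 1` only. -/
def uMap (a b : ℝ) (n : ℕ) (i : (k : ℕ) → (GamLE k → ℝ) → GamLE n → ℝ) (y : GamLE n → ℝ) :
    {r : ℕ} → Delta r → r ≤ n + 1 → ℝ
  | _, Delta.base, _ => 0
  | _, @Delta.node m k p q _ hkn hp hq ξ η ε ε', h =>
    have hmn : m ≤ n := Nat.le_of_succ_le_succ h
    ((ε : ℤ) : ℝ) * a * y ⟨⟨p, ξ⟩, le_trans hp (le_trans hkn.le hmn)⟩ +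
      ((ε' : ℤ) : ℝ) * b * (y ⟨⟨q, η⟩, le_trans hq hmn⟩ -
        i k (fun δ => y ⟨δ.1, le_trans δ.2 (le_trans hkn.le hmn)⟩) ⟨⟨q, η⟩, le_trans hq hmn⟩)

/-- `iExt a b n k` is the map `i_{k,n} : ℓ_∞(Γ_k) → ℓ_∞(Γ_n)` (used for `k ≤ n`, with `i_{n,n}` the
identity). It satisfies `i_{k,n+1} = i_n ∘ i_{k,n}`, where `i_n y` is `y` on `Γ_n` and `u_n y` on
`Δ_{n+1}`. -/
def iExt (a b : ℝ) : (n k : ℕ) → (GamLE k → ℝ) → GamLE n → ℝ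
  | 0, _, _, _ => 0
  | n + 1, k, x, γ =>
    if h : rank γ.1 ≤ k then x ⟨γ.1, h⟩
    else if h' : rank γ.1 ≤ n then iExt a b n k x ⟨γ.1, h'⟩
    else uMap a b n (iExt a b n) (iExt a b n k x) γ.1.2 γ.2

/-- `j_m : ℓ_∞(Γ_m) → ℝ^Γ`, `(j_m x)(δ) = (i_{m,n} x)(δ)` for `δ ∈ Γ_n`. -/
def jMap (a b : ℝ) (m : ℕ) (x : GamLE m → ℝ) (δ : Gam) : ℝ :=
  if h : rank δ ≤ m then x ⟨δ, h⟩ else iExt a b (rank δ) m x ⟨δ, le_rfl⟩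

/-- The Banach space `ℓ_∞(Γ)`. -/
abbrev LInf : Type := lp (fun _ : Gam => ℝ) ⊤

/-- The Banach space `ℓ_1(Γ)`. -/
abbrev LOne : Type := lp (fun _ : Gam => ℝ) 1

/-- The space `X_{a,b}`: the closure in `ℓ_∞(Γ)` of the union of the images of the `j_n`. (This is
an increasing union of linear subspaces, so the span is the union itself.) -/
noncomputable def X (a b : ℝ) : Submodule ℝ LInf :=
  (Submodule.span ℝ {f : LInf | ∃ (n : ℕ) (x : GamLE n → ℝ), (f : Gam → ℝ) = jMap a b n x}).topologicalClosure

/-- The parameters of the spaces of class `𝒳`. -/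
def ClassX (a b : ℝ) : Prop := a = 1 ∧ 0 < b ∧ b < 1 / 2

/-- The parameters of the spaces of class `𝒴`. -/
def ClassY (a b : ℝ) : Prop := 0 < b ∧ b < 1 / 2 ∧ 1 / 2 < a ∧ a < 1 ∧ 1 < a + b

/-- The constants `λ` of the construction. -/
def IsBDConstant (a b lam : ℝ) : Prop :=
  (ClassY a b ∧ lam = a / (1 - 2 * b)) ∨ (ClassX a b ∧ 1 < lam ∧ 1 + 2 * b * lam ≤ lam)

noncomputable section

open Classical in
/-- The unit vector `e_γ^*` of `ℓ_1(Γ)`. -/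
def eStar (γ : Gam) : LOne := lp.single 1 γ (1 : ℝ)

open Classical in
/-- For `γ` of rank `n + 1`, the vector `c_γ^* = i_n^* e_γ^*`, i.e.
`c_γ^* = ∑_{θ ∈ Γ_n} (i_n e_θ)(γ) e_θ^*`; for the element of `Γ_1` it is `0`. -/
def cStar (a b : ℝ) (γ : Gam) : LOne :=
  ∑ θ : GamLE (rank γ - 1),
    iExt a b (rank γ) (rank γ - 1) (Pi.single θ 1) ⟨γ, le_rfl⟩ • eStar θ.1

/-- `d_γ^* = e_γ^* - c_γ^*`. -/
def dStar (a b : ℝ) (γ : Gam) : LOne := eStar γ - cStar a b γ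

/-- `K` is the basis constant of the basis `(d_γ^*)` of `ℓ_1(Γ)`, for some enumeration of `Γ` that
lists the elements of smaller rank first. -/
def IsBasisConstant (a b K : ℝ) : Prop :=
  ∃ g : ℕ ≃ Gam, Monotone (fun i => rank (g i)) ∧
    IsLeast {K : ℝ | ∀ (m n : ℕ) (α : ℕ → ℝ), m ≤ n →
      ‖∑ i ∈ Finset.range m, α i • dStar a b (g i)‖ ≤
        K * ‖∑ i ∈ Finset.range n, α i • dStar a b (g i)‖} K

/-- `(n+1, k, ξ, η, ε, ε') ↦ (n+1, k, ξ, η, -ε, -ε')` (and the element of `Δ_1` is fixed). -/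
def tilde : {r : ℕ} → Delta r → Delta r
  | _, Delta.base => Delta.base
  | _, Delta.node hk hkn hp hq ξ η ε ε' => Delta.node hk hkn hp hq ξ η (-ε) (-ε')

/-- `τ ∈ {γ, tilde γ}`. -/
def InPair (γ : Gam) {r : ℕ} (τ : Delta r) : Prop :=
  (⟨r, τ⟩ : Gam) = γ ∨ (⟨r, τ⟩ : Gam) = ⟨γ.1, tilde γ.2⟩

open Classical in
/-- The underlying function `F : Γ → Γ` of the basic operator with base `γ`. On elements of rank
at most `rank γ` it interchanges `γ` and `tilde γ` and fixes everything else; an element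
`(m+1, l, θ, φ, ε, ε')` of larger rank is mapped to `(m+1, l, F θ, φ, ±ε, ε')` if `φ ∈ Γ_l` and to
`(m+1, l, F θ, F φ, ±ε, ±ε')` if `φ ∉ Γ_l`, where the first sign is `-` iff `θ ∈ {γ, tilde γ}` and the
second one is `-` iff `φ ∈ {γ, tilde γ}`. -/
def underlying (γ : Gam) : {r : ℕ} → Delta r → Delta r
  | _, Delta.base => Delta.base
  | _, @Delta.node m l _ q hk hkn hp hq θ φ ε ε' =>
    if m + 1 ≤ rank γ then
      if InPair γ (Delta.node hk hkn hp hq θ φ ε ε') then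
        tilde (Delta.node hk hkn hp hq θ φ ε ε')
      else Delta.node hk hkn hp hq θ φ ε ε'
    else if q ≤ l then
      Delta.node hk hkn hp hq (underlying γ θ) φ (if InPair γ θ then -ε else ε) ε'
    else
      Delta.node hk hkn hp hq (underlying γ θ) (underlying γ φ)
        (if InPair γ θ then -ε else ε) (if InPair γ φ then -ε' else ε')

open Classical in
/-- The defining property of the operator `S^*` on `ℓ_1(Γ)` with base `γ`: it maps `d_τ^*` to
`-d_{F(τ)}^*` if `τ ∈ {γ, tilde γ}`, and to `d_{F(τ)}^*` otherwise. -/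
def IsBasicStar (a b : ℝ) (γ : Gam) (S : LOne →L[ℝ] LOne) : Prop :=
  ∀ τ : Gam, S (dStar a b τ) =
    (if InPair γ τ.2 then (-1 : ℝ) else 1) • dStar a b ⟨τ.1, underlying γ τ.2⟩

open Classical in
/-- The bounded operator `S^*` on `ℓ_1(Γ)` with base `γ`. (It exists and is unique if `γ` has rank
at least `3`.) -/
def basicStar (a b : ℝ) (γ : Gam) : LOne →L[ℝ] LOne :=
  if h : ∃ S : LOne →L[ℝ] LOne, IsBasicStar a b γ S then h.choose else 0

/-- `T_{1,m}^* = S_{n_m}^* ∘ ⋯ ∘ S_{n_1}^*`, where `S_i^*` has base `base i`; the sequence is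
indexed from `0`, so that `n_j` is `n (j - 1)`. -/
def compStar (a b : ℝ) (base : ℕ → Gam) (n : ℕ → ℕ) : ℕ → (LOne →L[ℝ] LOne)
  | 0 => ContinuousLinearMap.id ℝ LOne
  | m + 1 => (basicStar a b (base (n m))).comp (compStar a b base n m)

/-- The pairing `⟨f, x⟩` that identifies `ℓ_∞(Γ)` with the dual of `ℓ_1(Γ)`. -/
def pairing (f : LInf) (x : LOne) : ℝ := ∑' γ : Gam, f γ * x γ

/-- `R : ℓ_1(Γ) → ℓ_1(Γ)` is the operator `T_{(n_j)}^*`, the pointwise limit of the `T_{1,m}^*`. -/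
def IsSeqStar (a b : ℝ) (base : ℕ → Gam) (n : ℕ → ℕ) (R : LOne →L[ℝ] LOne) : Prop :=
  ∀ x : LOne, Filter.Tendsto (fun m => compStar a b base n m x) Filter.atTop (nhds (R x))

/-- `T : X → X` is the restriction to `X` of the dual operator of `R : ℓ_1(Γ) → ℓ_1(Γ)`. -/
def IsDualRestriction (a b : ℝ) (R : LOne →L[ℝ] LOne) (T : X a b →L[ℝ] X a b) : Prop :=
  ∀ (f : X a b) (x : LOne), pairing (T f : LInf) x = pairing (f : LInf) (R x)

end

end BD

namespace BD

/-! Each basic operator is a signed permutation of the unit vectors. Changing both signs of a node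
negates the value that the extension formula gives there, and `F` and the signs are defined on later
ranks so that this change propagates. By induction on rank, σ_τ (j_k x)(F τ) = (j_k (σ · x∘F))(τ),
which is `pairSign_mul_jMap`. Hence e_τ^* ↦ σ_τ e_{Fτ}^* is an isometry of ℓ_1(Γ) that also sends
d_τ^* to σ_τ d_{Fτ}^*. It is the only such bounded operator, because the d_τ^* span all unit
vectors, and its dual preserves X.

The operator with base γ fixes all unit vectors of rank below that of γ. Along a strictly increasing
sequence, the products are therefore eventually constant on each unit vector; being isometries, they
converge pointwise (`tendsto_onLOne_limit`). The limit is again a signed permutation commuting with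
the extensions, so its dual is an isometry of X onto X.

For the separation, let i be the first index at which two sequences differ, say n_i < n'_i. At a
suitable τ of rank n_i + 1 the two limits give unit vectors of rank n_i + 1 with opposite signs. The
extension of the constant 1 from Γ_{n_i+1} has norm at most λ and detects this, so the distance is
at least 2/λ (`le_norm_sub_of_lt`), which is stronger than 1/(2λ). Uncountably many sequences then
give uncountably many disjoint balls. -/

/-! ### The extension maps j_k as a recursion on rank -/

theorem jMap_of_le (a b : ℝ) {k : ℕ} (x : GamLE k → ℝ) {τ : Gam} (h : rank τ ≤ k) :
    jMap a b k x τ = x ⟨τ, h⟩ :=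
  dif_pos h

/-- The value of an extension at γ does not depend on the level n at which it is computed, so the
finite stages can be dropped. -/
theorem iExt_eq_jMap (a b : ℝ) {n : ℕ} (k : ℕ) (x : GamLE k → ℝ) (γ : GamLE n) :
    iExt a b n k x γ = jMap a b k x γ.1 := by
  induction n with
  | zero =>
    obtain ⟨⟨r, τ⟩, h⟩ := γ
    cases τ <;> simp [rank] at h
  | succ n ih =>
    by_cases h : rank γ.1 ≤ k
    · rw [jMap_of_le a b x h, iExt, dif_pos h]
    · by_cases h' : rank γ.1 ≤ n
      · rw [iExt, dif_neg h, dif_pos h', ih]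
      · obtain ⟨⟨r, τ⟩, hr⟩ := γ
        have hrn : r = n + 1 := by
          change ¬ r ≤ n at h'
          change r ≤ n + 1 at hr
          omega
        subst hrn
        rw [jMap, dif_neg h]

theorem jMap_base_of_lt (a b : ℝ) {k : ℕ} (x : GamLE k → ℝ) (hk : k < 1) :
    jMap a b k x ⟨1, Delta.base⟩ = 0 := by
  rw [jMap, dif_neg (by simpa [rank] using hk), iExt, dif_neg (by simpa [rank] using hk),
    dif_neg (by simp [rank])]
  rfl

theorem jMap_node (a b : ℝ) {k : ℕ} (x : GamLE k → ℝ) {n l p q : ℕ} (hl : 1 ≤ l) (hln : l < n)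
    (hp : p ≤ l) (hq : q ≤ n) (ξ : Delta p) (η : Delta q) (ε ε' : ℤˣ) (hk : k < n + 1) :
    jMap a b k x ⟨n + 1, Delta.node hl hln hp hq ξ η ε ε'⟩ =
      ((ε : ℤ) : ℝ) * a * jMap a b k x ⟨p, ξ⟩ + ((ε' : ℤ) : ℝ) * b * (jMap a b k x ⟨q, η⟩ -
        jMap a b l (fun δ => jMap a b k x δ.1) ⟨q, η⟩) := by
  have h1 : ¬ rank (⟨n + 1, Delta.node hl hln hp hq ξ η ε ε'⟩ : Gam) ≤ k := not_le.2 hk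
  rw [jMap, dif_neg h1, iExt, dif_neg h1, dif_neg (by simp [rank])]
  simp only [uMap, iExt_eq_jMap]

theorem jMap_add (a b : ℝ) (k : ℕ) (x y : GamLE k → ℝ) (τ : Gam) :
    jMap a b k (fun θ => x θ + y θ) τ = jMap a b k x τ + jMap a b k y τ := by
  obtain ⟨r, t⟩ := τ
  induction r using Nat.strong_induction_on generalizing k with
  | _ r ih =>
    by_cases h : r ≤ k
    · simp only [jMap_of_le a b (τ := ⟨r, t⟩) _ h]
    cases t with
    | base => simp only [jMap_base_of_lt a b _ (not_le.1 h), add_zero]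
    | @node n l p q hl hln hp hq ξ η ε ε' =>
      rw [jMap_node _ _ _ _ _ _ _ _ _ _ _ (not_le.1 h), jMap_node _ _ _ _ _ _ _ _ _ _ _ (not_le.1 h),
        jMap_node _ _ _ _ _ _ _ _ _ _ _ (not_le.1 h), ih p (by omega), ih q (by omega)]
      have : (fun δ : GamLE l => jMap a b k (fun θ => x θ + y θ) δ.1) =
          fun δ => jMap a b k x δ.1 + jMap a b k y δ.1 := by
        funext δ
        exact ih δ.1.1 (by have := δ.2; change δ.1.1 ≤ l at this; omega) _ _ _ _
      rw [this, ih q (by omega) l]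
      ring

theorem jMap_smul (a b : ℝ) (k : ℕ) (c : ℝ) (x : GamLE k → ℝ) (τ : Gam) :
    jMap a b k (fun θ => c * x θ) τ = c * jMap a b k x τ := by
  obtain ⟨r, t⟩ := τ
  induction r using Nat.strong_induction_on generalizing k with
  | _ r ih =>
    by_cases h : r ≤ k
    · simp only [jMap_of_le a b (τ := ⟨r, t⟩) _ h]
    cases t with
    | base => simp only [jMap_base_of_lt a b _ (not_le.1 h), mul_zero]
    | @node n l p q hl hln hp hq ξ η ε ε' =>
      rw [jMap_node _ _ _ _ _ _ _ _ _ _ _ (not_le.1 h), jMap_node _ _ _ _ _ _ _ _ _ _ _ (not_le.1 h),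
        ih p (by omega), ih q (by omega)]
      have : (fun δ : GamLE l => jMap a b k (fun θ => c * x θ) δ.1) =
          fun δ => c * jMap a b k x δ.1 := by
        funext δ
        exact ih δ.1.1 (by have := δ.2; change δ.1.1 ≤ l at this; omega) _ _ _
      rw [this, ih q (by omega) l]
      ring

/-- `j_m` as a linear map into the space of all functions on `Γ`. -/
noncomputable def jLin (a b : ℝ) (k : ℕ) : (GamLE k → ℝ) →ₗ[ℝ] (Gam → ℝ) where
  toFun := jMap a b k
  map_add' x y := funext fun τ => jMap_add a b k x y τ
  map_smul' c x := funext fun τ => jMap_smul a b k c x τ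

theorem sum_jMap_single (a b : ℝ) (k : ℕ) [DecidableEq (GamLE k)] (x : GamLE k → ℝ) (τ : Gam) :
    ∑ θ, jMap a b k (Pi.single θ 1) τ * x θ = jMap a b k x τ := by
  have h := congrFun (LinearMap.pi_apply_eq_sum_univ (jLin a b k) x) τ
  rw [Finset.sum_apply] at h
  refine Eq.trans (Finset.sum_congr rfl fun θ _ => ?_) h.symm
  rw [Pi.smul_apply, smul_eq_mul, mul_comm]
  congr 2
  funext i
  simp [Pi.single_apply, eq_comm]

/-- Extensions compose. This is what makes the bracket in the node formula vanish on the image of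
j_k when k ≤ l. -/
theorem jMap_jMap_of_le (a b : ℝ) {k l : ℕ} (hkl : k ≤ l) (x : GamLE k → ℝ) (τ : Gam) :
    jMap a b l (fun θ => jMap a b k x θ.1) τ = jMap a b k x τ := by
  obtain ⟨r, t⟩ := τ
  induction r using Nat.strong_induction_on generalizing l with
  | _ r ih =>
    by_cases h : r ≤ l
    · rw [jMap_of_le a b (τ := ⟨r, t⟩) _ h]
    cases t with
    | base => rw [jMap_base_of_lt a b _ (not_le.1 h),
        jMap_base_of_lt a b _ (hkl.trans_lt (not_le.1 h))]
    | @node n m p q hm hmn hp hq ξ η ε ε' =>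
      rw [jMap_node _ _ _ _ _ _ _ _ _ _ _ (not_le.1 h),
        jMap_node _ _ _ _ _ _ _ _ _ _ _ (hkl.trans_lt (not_le.1 h)),
        ih p (by omega) hkl, ih q (by omega) hkl]
      congr 5
      funext δ
      exact ih δ.1.1 (by have := δ.2; change δ.1.1 ≤ m at this; omega) hkl _

/-! ### The underlying permutation F and its compatibility with j_k -/

theorem tilde_tilde {r : ℕ} (t : Delta r) : tilde (tilde t) = t := by
  cases t <;> simp [tilde]

theorem jMap_tilde (a b : ℝ) {k r : ℕ} (x : GamLE k → ℝ) (hk : k < r) (t : Delta r) :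
    jMap a b k x ⟨r, tilde t⟩ = -jMap a b k x ⟨r, t⟩ := by
  cases t with
  | base => rw [tilde, jMap_base_of_lt a b _ hk, neg_zero]
  | node =>
    rw [tilde, jMap_node _ _ _ _ _ _ _ _ _ _ _ hk, jMap_node _ _ _ _ _ _ _ _ _ _ _ hk]
    push_cast
    ring

theorem InPair.rank_eq {γ : Gam} {r : ℕ} {t : Delta r} (h : InPair γ t) : r = rank γ := by
  rcases h with h | h <;> exact congrArg Sigma.fst h

theorem inPair_tilde {γ : Gam} {r : ℕ} {t : Delta r} : InPair γ (tilde t) ↔ InPair γ t := by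
  have key : ∀ {r : ℕ} {t : Delta r}, InPair γ t → InPair γ (tilde t) := by
    intro r t h
    rcases h with h | h
    · subst h
      exact Or.inr rfl
    · obtain ⟨s, u⟩ := γ
      obtain rfl : r = s := congrArg Sigma.fst h
      obtain rfl : t = tilde u := by simpa using h
      exact Or.inl (by rw [tilde_tilde])
  exact ⟨fun h => by simpa [tilde_tilde] using key h, key⟩

open Classical in
theorem underlying_of_le {γ : Gam} {r : ℕ} (t : Delta r) (h : r ≤ rank γ) :
    underlying γ t = if InPair γ t then tilde t else t := by
  cases t with
  | base => simp [underlying, tilde]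
  | node => rw [underlying, if_pos h]

theorem underlying_of_lt {γ : Gam} {r : ℕ} (t : Delta r) (h : r < rank γ) :
    underlying γ t = t := by
  rw [underlying_of_le t h.le, if_neg fun h' => h.ne h'.rank_eq]

theorem inPair_underlying {γ : Gam} {r : ℕ} {t : Delta r} :
    InPair γ (underlying γ t) ↔ InPair γ t := by
  by_cases hr : r ≤ rank γ
  · rw [underlying_of_le t hr]
    split_ifs with h
    · exact inPair_tilde
    · rfl
  · exact ⟨fun h => (hr h.rank_eq.le).elim, fun h => (hr h.rank_eq.le).elim⟩

/-- Membership in the exchanged pair is invariant under F, so the same signs are flipped twice. Thus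
F is its own inverse, hence a bijection. -/
theorem underlying_underlying (γ : Gam) {r : ℕ} (t : Delta r) :
    underlying γ (underlying γ t) = t := by
  classical
  induction t with
  | base => rfl
  | @node n l p q hl hln hp hq ξ η ε ε' ihξ ihη =>
    by_cases hr : n + 1 ≤ rank γ
    · rw [underlying_of_le _ hr, if_congr inPair_underlying rfl rfl, underlying_of_le _ hr]
      split_ifs <;> simp [tilde_tilde]
    have hs : ∀ {r : ℕ} (t : Delta r) (e : ℤˣ), (if InPair γ (underlying γ t) then
        -(if InPair γ t then -e else e) else (if InPair γ t then -e else e)) = e := by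
      intro r t e
      by_cases h : InPair γ t
      · rw [if_pos (inPair_underlying.2 h), if_pos h, neg_neg]
      · rw [if_neg (mt inPair_underlying.1 h), if_neg h]
    by_cases hql : q ≤ l
    · simp only [underlying, if_neg hr, if_pos hql, ihξ]
      congr 1
      convert hs ξ ε
    · simp only [underlying, if_neg hr, if_neg hql, ihξ, ihη]
      congr 1
      · convert hs ξ ε
      · convert hs η ε'

open Classical in
/-- The sign `σ_τ`. -/
noncomputable def pairSign (γ τ : Gam) : ℝ := if InPair γ τ.2 then -1 else 1

/-- Strong induction on rank, for all k at once, since the node formula also extends from the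
intermediate level l. -/
theorem pairSign_mul_jMap (a b : ℝ) (γ : Gam) (k : ℕ) (x : GamLE k → ℝ) (τ : Gam) :
    pairSign γ τ * jMap a b k x ⟨τ.1, underlying γ τ.2⟩ =
      jMap a b k (fun θ => pairSign γ θ.1 * x ⟨⟨θ.1.1, underlying γ θ.1.2⟩, θ.2⟩) τ := by
  obtain ⟨r, t⟩ := τ
  induction r using Nat.strong_induction_on generalizing k with
  | _ r ih =>
    by_cases h : r ≤ k
    · rw [jMap_of_le a b (τ := ⟨r, t⟩) _ h, jMap_of_le a b (τ := ⟨r, underlying γ t⟩) _ h]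
    have hk := not_le.1 h
    by_cases hr : r ≤ rank γ
    -- Here k < r ≤ rank γ, so F and the signs act trivially on Γ_k, and only the exchange at τ
    -- itself matters.
    · have hx : (fun θ : GamLE k => pairSign γ θ.1 * x ⟨⟨θ.1.1, underlying γ θ.1.2⟩, θ.2⟩) = x := by
        funext θ
        have hθ : θ.1.1 < rank γ := lt_of_le_of_lt θ.2 (hk.trans_le hr)
        rw [pairSign, if_neg fun h' => hθ.ne h'.rank_eq, one_mul]
        congr 3
        exact underlying_of_lt _ hθ
      rw [hx]
      simp only [pairSign, underlying_of_le t hr]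
      split_ifs
      · rw [jMap_tilde a b x hk]
        ring
      · ring
    cases t with
    | base =>
      rw [jMap_base_of_lt a b _ hk]
      simp only [underlying]
      rw [jMap_base_of_lt a b _ hk, mul_zero]
    | @node n l p q hl hln hp hq ξ η ε ε' =>
      have h1 : pairSign γ ⟨n + 1, Delta.node hl hln hp hq ξ η ε ε'⟩ = 1 :=
        if_neg fun h' => hr h'.rank_eq.le
      have hs : ∀ (c : Prop) [Decidable c] (e : ℤˣ),
          (((if c then -e else e : ℤˣ) : ℤ) : ℝ) = (if c then -1 else 1 : ℝ) * ((e : ℤ) : ℝ) := by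
        intro c _ e
        split_ifs <;> simp
      have hξ := ih p (by omega) k x ξ
      have hη := ih q (by omega) k x η
      rw [h1, one_mul, jMap_node _ _ _ _ _ _ _ _ _ _ _ hk, ← hξ]
      have hη' := ih q (by omega) l (fun θ => jMap a b k x θ.1) η
      have hl' : (fun θ : GamLE l => pairSign γ θ.1 *
          jMap a b k x (⟨θ.1.1, underlying γ θ.1.2⟩ : Gam)) = fun θ => jMap a b k
            (fun θ => pairSign γ θ.1 * x ⟨⟨θ.1.1, underlying γ θ.1.2⟩, θ.2⟩) θ.1 := by
        funext θ
        exact ih θ.1.1 (by have := θ.2; change θ.1.1 ≤ l at this; omega) k x θ.1.2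
      rw [hl'] at hη'
      -- If η ∈ Γ_l the bracket in the node formula is zero on both sides, so leaving η unmoved is
      -- harmless; otherwise the induction hypothesis transforms both terms of the bracket.
      by_cases hql : q ≤ l
      · simp only [underlying, if_neg hr, if_pos hql]
        rw [jMap_node _ _ _ _ _ _ _ _ _ _ _ hk, jMap_of_le a b (τ := ⟨q, η⟩) _ hql,
          jMap_of_le a b (τ := ⟨q, η⟩) _ hql, hs]
        simp only [pairSign]
        ring
      · simp only [underlying, if_neg hr, if_neg hql]
        rw [jMap_node _ _ _ _ _ _ _ _ _ _ _ hk, ← hη', ← hη, hs, hs]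
        simp only [pairSign]
        ring

/-! ### Signed permutations of ℓ_p and the pairing of ℓ_∞ with ℓ_1 -/

open scoped ENNReal

section SignedPerm

variable {α : Type*}

theorem memℓp_signedPerm {p : ℝ≥0∞} (hp : p ≠ 0) (E : α ≃ α) (s : α → ℝ) (hs : ∀ i, |s i| = 1)
    {f : α → ℝ} (hf : Memℓp f p) : Memℓp (fun i => s i * f (E i)) p := by
  rcases p.trichotomy with rfl | rfl | h
  · exact (hp rfl).elim
  · rw [memℓp_infty_iff] at hf ⊢
    refine hf.mono ?_
    rintro _ ⟨i, rfl⟩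
    exact ⟨E i, by simp [hs]⟩
  · rw [memℓp_gen_iff h] at hf ⊢
    simpa [hs, Function.comp_def] using (E.summable_iff (f := fun i => |f i| ^ p.toReal)).2 hf

/-- The isometry `f ↦ (i ↦ s_i f(E i))` of `ℓ_p`. -/
noncomputable def signedPerm (p : ℝ≥0∞) [Fact (1 ≤ p)] (E : α ≃ α) (s : α → ℝ)
    (hs : ∀ i, |s i| = 1) : lp (fun _ : α => ℝ) p ≃ₗᵢ[ℝ] lp (fun _ : α => ℝ) p where
  toFun f := ⟨fun i => s i * f (E i),
    memℓp_signedPerm (zero_lt_one.trans_le Fact.out).ne' E s hs f.2⟩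
  invFun f := ⟨fun i => s (E.symm i) * f (E.symm i),
    memℓp_signedPerm (zero_lt_one.trans_le Fact.out).ne' E.symm (fun i => s (E.symm i))
      (fun _ => hs _) f.2⟩
  map_add' f g := by
    ext i
    exact mul_add _ _ _
  map_smul' c f := by
    ext i
    exact mul_left_comm _ _ _
  left_inv f := by
    ext i
    have : s (E.symm i) * s (E.symm i) = 1 := by rw [← abs_mul_abs_self, hs, one_mul]
    simp [← mul_assoc, this]
  right_inv f := by
    ext i
    have : s i * s i = 1 := by rw [← abs_mul_abs_self, hs, one_mul]
    simp [← mul_assoc, this]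
  norm_map' f := by
    have h0 : p ≠ 0 := (zero_lt_one.trans_le Fact.out).ne'
    rcases p.trichotomy with rfl | rfl | h
    · exact (h0 rfl).elim
    · rw [lp.norm_eq_ciSup, lp.norm_eq_ciSup]
      simpa [hs] using E.surjective.iSup_comp (fun i => |f i|)
    · rw [lp.norm_eq_tsum_rpow h, lp.norm_eq_tsum_rpow h]
      simpa [hs] using congrArg (· ^ (1 / p.toReal)) (E.tsum_eq (fun i => |f i| ^ p.toReal))

end SignedPerm

theorem LOne.hasSum_abs (x : LOne) : HasSum (fun γ => |x γ|) ‖x‖ := by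
  simpa using lp.hasSum_norm (p := 1) (by simp) x

theorem summable_pairing (f : LInf) (x : LOne) : Summable fun γ => f γ * x γ := by
  refine Summable.of_norm_bounded ((LOne.hasSum_abs x).summable.mul_left ‖f‖) fun γ => ?_
  rw [norm_mul, Real.norm_eq_abs (x γ)]
  exact mul_le_mul_of_nonneg_right (lp.norm_apply_le_norm ENNReal.top_ne_zero f γ) (abs_nonneg _)

theorem abs_pairing_le (f : LInf) (x : LOne) : |pairing f x| ≤ ‖f‖ * ‖x‖ := by
  rw [← Real.norm_eq_abs]
  refine tsum_of_norm_bounded ((LOne.hasSum_abs x).mul_left ‖f‖) fun γ => ?_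
  rw [norm_mul, Real.norm_eq_abs (x γ)]
  exact mul_le_mul_of_nonneg_right (lp.norm_apply_le_norm ENNReal.top_ne_zero f γ) (abs_nonneg _)

/-- The functional on `ℓ_1(Γ)` given by an element of `ℓ_∞(Γ)`. -/
noncomputable def pairingLin (f : LInf) : LOne →ₗ[ℝ] ℝ where
  toFun := pairing f
  map_add' x y := by
    simp only [pairing, lp.coeFn_add, Pi.add_apply, mul_add]
    exact (summable_pairing f x).tsum_add (summable_pairing f y)
  map_smul' c x := by
    simp only [pairing, lp.coeFn_smul, Pi.smul_apply, smul_eq_mul, mul_left_comm, tsum_mul_left,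
      RingHom.id_apply]

theorem pairingLin_apply (f : LInf) (x : LOne) : pairingLin f x = pairing f x := rfl

theorem eStar_apply (γ τ : Gam) [Decidable (τ = γ)] : eStar γ τ = if τ = γ then 1 else 0 := by
  classical
  rw [eStar, lp.single_apply, Pi.single_apply]
  congr

theorem pairing_eStar (f : LInf) (γ : Gam) : pairing f (eStar γ) = f γ := by
  classical
  rw [pairing, tsum_eq_single γ fun τ h => by rw [eStar_apply, if_neg h, mul_zero], eStar_apply,
    if_pos rfl, mul_one]

theorem norm_eStar (γ : Gam) : ‖eStar γ‖ = 1 := by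
  classical
  rw [eStar, lp.norm_single (by simp), norm_one]

theorem LOne.ext_pairing {x y : LOne} (h : ∀ f : LInf, pairing f x = pairing f y) : x = y := by
  classical
  ext γ
  have key : ∀ z : LOne, pairing (lp.single ⊤ γ (1 : ℝ)) z = z γ := fun z => by
    rw [pairing, tsum_eq_single γ fun τ h => by rw [lp.single_apply_ne _ _ _ h, zero_mul],
      lp.single_apply_self, one_mul]
  rw [← key, ← key, h]

theorem hasSum_eStar (x : LOne) : HasSum (fun γ => x γ • eStar γ) x := by
  classical
  convert lp.hasSum_single (p := 1) (by simp) x using 2 with γ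
  ext τ
  rw [lp.coeFn_smul, Pi.smul_apply, eStar_apply, lp.single_apply, Pi.single_apply]
  split_ifs <;> simp

/-- d_τ^* measures how far f at τ is from the extension of its restriction to lower ranks. In
particular it annihilates the image of j_k when rank τ > k. -/
theorem pairing_dStar (a b : ℝ) (f : LInf) (τ : Gam) :
    pairing f (dStar a b τ) = f τ - jMap a b (rank τ - 1) (fun θ => f θ.1) τ := by
  classical
  rw [← pairingLin_apply, dStar, map_sub, cStar, map_sum, pairingLin_apply, pairing_eStar]
  congr 1
  refine Eq.trans (Finset.sum_congr rfl fun θ _ => ?_) (sum_jMap_single a b _ _ τ)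
  rw [map_smul, pairingLin_apply, pairing_eStar, iExt_eq_jMap, smul_eq_mul]

/-! ### The group of signed permutations commuting with the extensions -/

/-- A signed rank preserving permutation of `Γ` that commutes with the extension operators. -/
structure SignedAut (a b : ℝ) where
  equiv : Gam ≃ Gam
  sign : Gam → ℝ
  abs_sign : ∀ τ, |sign τ| = 1
  rank_equiv : ∀ τ, rank (equiv τ) = rank τ
  comm : ∀ (k : ℕ) (x : GamLE k → ℝ) (τ : Gam), sign τ * jMap a b k x (equiv τ) =
    jMap a b k (fun θ => sign θ.1 * x ⟨equiv θ.1, (rank_equiv θ.1).trans_le θ.2⟩) τ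

namespace SignedAut

variable {a b : ℝ} (A B : SignedAut a b)

theorem sign_mul_sign (τ : Gam) : A.sign τ * A.sign τ = 1 := by
  rw [← abs_mul_abs_self, A.abs_sign, one_mul]

theorem rank_equiv_symm (τ : Gam) : rank (A.equiv.symm τ) = rank τ := by
  rw [← A.rank_equiv, Equiv.apply_symm_apply]

/-- The identity. -/
def refl (a b : ℝ) : SignedAut a b where
  equiv := Equiv.refl _
  sign _ := 1
  abs_sign _ := abs_one
  rank_equiv _ := rfl
  comm k x τ := by simp

/-- The inverse. -/
def symm : SignedAut a b where
  equiv := A.equiv.symm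
  sign τ := A.sign (A.equiv.symm τ)
  abs_sign τ := A.abs_sign _
  rank_equiv := A.rank_equiv_symm
  comm k x τ := by
    -- The rule for A is applied to the function transported by the inverse, at the preimage of τ,
    -- so that all signs cancel in pairs.
    have h := A.comm k (fun θ => A.sign (A.equiv.symm θ.1) *
      x ⟨A.equiv.symm θ.1, (A.rank_equiv_symm θ.1).trans_le θ.2⟩) (A.equiv.symm τ)
    simp only [Equiv.apply_symm_apply, Equiv.symm_apply_apply, ← mul_assoc, sign_mul_sign,
      one_mul] at h
    rw [← h, ← mul_assoc, sign_mul_sign, one_mul]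

/-- The composition. -/
def trans : SignedAut a b where
  equiv := A.equiv.trans B.equiv
  sign τ := A.sign τ * B.sign (A.equiv τ)
  abs_sign τ := by rw [abs_mul, A.abs_sign, B.abs_sign, one_mul]
  rank_equiv τ := (B.rank_equiv _).trans (A.rank_equiv τ)
  comm k x τ := by
    simp only [Equiv.trans_apply, mul_assoc]
    rw [B.comm, A.comm]

/-- The limit of a sequence that is eventually constant on each `Γ_n`. -/
def limit (A : ℕ → SignedAut a b)
    (hA : ∀ τ m, rank τ ≤ m → (A m).equiv τ = (A (rank τ)).equiv τ ∧
      (A m).sign τ = (A (rank τ)).sign τ) : SignedAut a b where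
  equiv :=
    { toFun := fun τ => (A (rank τ)).equiv τ
      invFun := fun τ => (A (rank τ)).equiv.symm τ
      left_inv := fun τ => by
        simp only [(A _).rank_equiv, Equiv.symm_apply_apply]
      right_inv := fun τ => by
        simp only [(A _).rank_equiv_symm, Equiv.apply_symm_apply] }
  sign τ := (A (rank τ)).sign τ
  abs_sign τ := (A _).abs_sign τ
  rank_equiv τ := (A _).rank_equiv τ
  comm k x τ := by
    -- At this index the sequence is already stable both at τ and on all of Γ_k, the only places the
    -- identity involves.
    have h := (A (max k (rank τ))).comm k x τ
    rw [(hA τ _ (le_max_right _ _)).1, (hA τ _ (le_max_right _ _)).2] at h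
    refine h.trans ?_
    congr 1
    funext θ
    have hθ := hA θ.1 (max k (rank τ)) (θ.2.trans (le_max_left _ _))
    simp only [hθ.1, hθ.2, Equiv.coe_fn_mk]

/-- The basic signed permutation with base `γ`. -/
noncomputable def basic (a b : ℝ) (γ : Gam) : SignedAut a b where
  equiv :=
    { toFun := fun τ => ⟨τ.1, underlying γ τ.2⟩
      invFun := fun τ => ⟨τ.1, underlying γ τ.2⟩
      left_inv := fun τ => by simp only [underlying_underlying]
      right_inv := fun τ => by simp only [underlying_underlying] }
  sign := pairSign γ
  abs_sign τ := by
    rw [pairSign]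
    split_ifs <;> simp
  rank_equiv τ := rfl
  comm := pairSign_mul_jMap a b γ

/-- The action on `ℓ_∞(Γ)`. -/
noncomputable def onLInf : LInf ≃ₗᵢ[ℝ] LInf := signedPerm ⊤ A.equiv A.sign A.abs_sign

/-- The action on `ℓ_1(Γ)`, with `e_τ^* ↦ σ_τ e_{F(τ)}^*`. -/
noncomputable def onLOne : LOne ≃ₗᵢ[ℝ] LOne :=
  signedPerm 1 A.symm.equiv A.symm.sign A.symm.abs_sign

@[simp]
theorem onLInf_apply (f : LInf) (τ : Gam) : A.onLInf f τ = A.sign τ * f (A.equiv τ) := rfl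

theorem onLOne_apply (x : LOne) (τ : Gam) :
    A.onLOne x τ = A.sign (A.equiv.symm τ) * x (A.equiv.symm τ) := rfl

theorem onLInf_symm_onLInf (f : LInf) : A.symm.onLInf (A.onLInf f) = f :=
  A.onLInf.symm_apply_apply f

theorem onLInf_onLInf_symm (f : LInf) : A.onLInf (A.symm.onLInf f) = f :=
  A.onLInf.apply_symm_apply f

theorem pairing_onLInf (f : LInf) (x : LOne) :
    pairing (A.onLInf f) x = pairing f (A.onLOne x) := by
  rw [pairing, pairing, ← A.equiv.tsum_eq (fun τ => f τ * A.onLOne x τ)]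
  refine tsum_congr fun τ => ?_
  rw [onLInf_apply, onLOne_apply, Equiv.symm_apply_apply]
  ring

theorem onLOne_eStar (τ : Gam) : A.onLOne (eStar τ) = A.sign τ • eStar (A.equiv τ) := by
  refine LOne.ext_pairing fun f => ?_
  rw [← pairing_onLInf, pairing_eStar, onLInf_apply, ← pairingLin_apply, map_smul,
    pairingLin_apply, pairing_eStar, smul_eq_mul]

theorem onLOne_dStar (τ : Gam) :
    A.onLOne (dStar a b τ) = A.sign τ • dStar a b (A.equiv τ) := by
  refine LOne.ext_pairing fun f => ?_
  rw [← pairing_onLInf, pairing_dStar, ← pairingLin_apply, map_smul, pairingLin_apply,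
    pairing_dStar, smul_eq_mul, mul_sub, A.rank_equiv]
  congr 1
  exact (A.comm _ (fun θ => f θ.1) τ).symm

theorem onLOne_trans (x : LOne) : (A.trans B).onLOne x = B.onLOne (A.onLOne x) := by
  refine LOne.ext_pairing fun f => ?_
  rw [← pairing_onLInf, ← pairing_onLInf, ← pairing_onLInf]
  congr 1
  ext τ
  exact mul_assoc _ _ _

/-- The commutation rule turns j_n x into j_n of a transformed vector on the same Γ_n, so the
generators are permuted; continuity passes to the closure. -/
theorem onLInf_mem_X {f : LInf} (hf : f ∈ X a b) : A.onLInf f ∈ X a b := by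
  have h : X a b ≤ (X a b).comap (A.onLInf.toLinearEquiv : LInf →ₗ[ℝ] LInf) := by
    refine Submodule.topologicalClosure_minimal _ (Submodule.span_le.2 ?_)
      ((Submodule.isClosed_topologicalClosure _).preimage A.onLInf.continuous)
    rintro f ⟨n, x, hf⟩
    refine Submodule.le_topologicalClosure _ (Submodule.subset_span ⟨n,
      fun θ => A.sign θ.1 * x ⟨A.equiv θ.1, (A.rank_equiv θ.1).trans_le θ.2⟩, ?_⟩)
    funext τ
    rw [← A.comm, ← hf]
    rfl
  exact h hf

/-- The action on `X`. -/
noncomputable def onX : X a b ≃ₗᵢ[ℝ] X a b where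
  toFun f := ⟨A.onLInf f, A.onLInf_mem_X f.2⟩
  invFun f := ⟨A.symm.onLInf f, A.symm.onLInf_mem_X f.2⟩
  map_add' _ _ := Subtype.ext (map_add A.onLInf _ _)
  map_smul' c f := Subtype.ext (map_smul A.onLInf c (f : LInf))
  left_inv f := Subtype.ext (A.onLInf_symm_onLInf f)
  right_inv f := Subtype.ext (A.onLInf_onLInf_symm f)
  norm_map' f := A.onLInf.norm_map f

theorem isDualRestriction_onX :
    IsDualRestriction a b (A.onLOne.toContinuousLinearEquiv : LOne →L[ℝ] LOne)
      (A.onX.toContinuousLinearEquiv : X a b →L[ℝ] X a b) :=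
  fun f x => A.pairing_onLInf f x

end SignedAut

/-! ### Uniqueness of the basic operators and convergence of their products -/

open Filter Topology

theorem rank_pos (τ : Gam) : 0 < rank τ := by
  obtain ⟨r, t⟩ := τ
  cases t <;> simp [rank]

/-- The system is triangular: e_τ^* = d_τ^* + c_τ^*, and c_τ^* involves only smaller ranks. -/
theorem eStar_mem_span_dStar (a b : ℝ) (τ : Gam) :
    eStar τ ∈ Submodule.span ℝ (Set.range (dStar a b)) := by
  induction hr : rank τ using Nat.strong_induction_on generalizing τ with
  | _ r ih =>
    have h : eStar τ = dStar a b τ + cStar a b τ := (sub_add_cancel _ _).symm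
    rw [h]
    refine Submodule.add_mem _ (Submodule.subset_span ⟨τ, rfl⟩)
      (Submodule.sum_mem _ fun θ _ => Submodule.smul_mem _ _ (ih _ ?_ θ.1 rfl))
    have h1 := rank_pos τ
    have h2 := θ.2
    omega

theorem clm_ext_eStar {S T : LOne →L[ℝ] LOne} (h : ∀ τ, S (eStar τ) = T (eStar τ)) : S = T := by
  ext1 x
  refine ((hasSum_eStar x).mapL S).unique ?_
  simpa only [map_smul, h] using (hasSum_eStar x).mapL T

theorem clm_ext_dStar (a b : ℝ) {S T : LOne →L[ℝ] LOne}
    (h : ∀ τ, S (dStar a b τ) = T (dStar a b τ)) : S = T := by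
  refine clm_ext_eStar fun τ => ?_
  have hle : Submodule.span ℝ (Set.range (dStar a b)) ≤
      LinearMap.eqLocus (S : LOne →ₗ[ℝ] LOne) (T : LOne →ₗ[ℝ] LOne) := by
    rw [Submodule.span_le]
    rintro _ ⟨τ, rfl⟩
    exact h τ
  exact hle (eStar_mem_span_dStar a b τ)

theorem isBasicStar_basic (a b : ℝ) (γ : Gam) :
    IsBasicStar a b γ ((SignedAut.basic a b γ).onLOne.toContinuousLinearEquiv : LOne →L[ℝ] LOne) :=
  fun τ => (SignedAut.basic a b γ).onLOne_dStar τ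

theorem isBasicStar_basicStar (a b : ℝ) (γ : Gam) : IsBasicStar a b γ (basicStar a b γ) := by
  have h : ∃ S, IsBasicStar a b γ S := ⟨_, isBasicStar_basic a b γ⟩
  rw [basicStar, dif_pos h]
  exact h.choose_spec

theorem IsBasicStar.eq {a b : ℝ} {γ : Gam} {S T : LOne →L[ℝ] LOne} (hS : IsBasicStar a b γ S)
    (hT : IsBasicStar a b γ T) : S = T :=
  clm_ext_dStar a b fun τ => (hS τ).trans (hT τ).symm

theorem basicStar_apply (a b : ℝ) (γ : Gam) (x : LOne) :
    basicStar a b γ x = (SignedAut.basic a b γ).onLOne x :=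
  DFunLike.congr_fun ((isBasicStar_basicStar a b γ).eq (isBasicStar_basic a b γ)) x

namespace SignedAut

theorem basic_of_rank_lt (a b : ℝ) {γ τ : Gam} (h : rank τ < rank γ) :
    (basic a b γ).equiv τ = τ ∧ (basic a b γ).sign τ = 1 :=
  ⟨congrArg (Sigma.mk τ.1) (underlying_of_lt τ.2 h), if_neg fun h' => h.ne h'.rank_eq⟩

theorem basic_self (a b : ℝ) (γ : Gam) : (basic a b γ).sign γ = -1 :=
  if_pos (Or.inl rfl)

/-- The signed permutation underlying `T_{1,m}^*`. -/
noncomputable def seq (a b : ℝ) (base : ℕ → Gam) (n : ℕ → ℕ) : ℕ → SignedAut a b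
  | 0 => refl a b
  | m + 1 => (seq a b base n m).trans (basic a b (base (n m)))

theorem compStar_apply (a b : ℝ) (base : ℕ → Gam) (n : ℕ → ℕ) (m : ℕ) (x : LOne) :
    compStar a b base n m x = (seq a b base n m).onLOne x := by
  induction m generalizing x with
  | zero =>
    ext τ
    exact (one_mul _).symm
  | succ m ih =>
    rw [compStar, ContinuousLinearMap.comp_apply, ih, basicStar_apply, seq, onLOne_trans]

theorem seq_congr (a b : ℝ) (base : ℕ → Gam) {n n' : ℕ → ℕ} {m : ℕ} (h : ∀ i < m, n i = n' i) :
    seq a b base n m = seq a b base n' m := by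
  induction m with
  | zero => rfl
  | succ m ih => rw [seq, seq, ih fun i hi => h i (hi.trans m.lt_succ_self), h m m.lt_succ_self]

theorem seq_stable (a b : ℝ) (base : ℕ → Gam) (n : ℕ → ℕ) {τ : Gam} {m₀ : ℕ}
    (h : ∀ j, m₀ ≤ j → rank τ < rank (base (n j))) {m : ℕ} (hm : m₀ ≤ m) :
    (seq a b base n m).equiv τ = (seq a b base n m₀).equiv τ ∧
      (seq a b base n m).sign τ = (seq a b base n m₀).sign τ := by
  induction m, hm using Nat.le_induction with
  | base => exact ⟨rfl, rfl⟩
  | succ m hm ih =>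
    have hb := basic_of_rank_lt a b (γ := base (n m)) (τ := (seq a b base n m).equiv τ)
      (((seq a b base n m).rank_equiv τ).trans_lt (h m hm))
    constructor
    · rw [seq, trans, Equiv.trans_apply, hb.1, ih.1]
    · simp only [seq, trans, hb.2, ih.2, mul_one]

variable {a b : ℝ}

theorem tendsto_onLOne_limit (A : ℕ → SignedAut a b)
    (hA : ∀ τ m, rank τ ≤ m → (A m).equiv τ = (A (rank τ)).equiv τ ∧
      (A m).sign τ = (A (rank τ)).sign τ) (x : LOne) :
    Tendsto (fun m => (A m).onLOne x) atTop (𝓝 ((limit A hA).onLOne x)) := by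
  rw [Metric.tendsto_atTop]
  intro ε hε
  obtain ⟨s, hs⟩ := ((hasSum_eStar x).eventually (Metric.ball_mem_nhds x (half_pos hε))).exists
  refine ⟨s.sup rank, fun m hm => ?_⟩
  -- A finitely supported approximation of x within ε/2. Beyond the largest rank in its support the
  -- operators agree with the limit on y, and isometry controls the remainder.
  set y := ∑ γ ∈ s, x γ • eStar γ with hy
  have heq : (A m).onLOne y = (limit A hA).onLOne y := by
    simp only [hy, map_sum, map_smul, onLOne_eStar]
    refine Finset.sum_congr rfl fun τ hτ => ?_
    have h := hA τ m ((Finset.le_sup (f := rank) hτ).trans hm)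
    rw [h.1, h.2]
    rfl
  calc dist ((A m).onLOne x) ((limit A hA).onLOne x)
      ≤ dist ((A m).onLOne x) ((A m).onLOne y) +
        dist ((A m).onLOne y) ((limit A hA).onLOne x) := dist_triangle _ _ _
    _ = dist y x + dist y x := by
        rw [(A m).onLOne.dist_map, heq, (limit A hA).onLOne.dist_map, dist_comm x y]
    _ < ε := by
        have : dist y x < ε / 2 := hs
        linarith

end SignedAut

theorem rank_lt_rank_base {base : ℕ → Gam} (hbase : ∀ i, 2 ≤ i → rank (base i) = i + 1)
    {n : ℕ → ℕ} (hn : StrictMono n) (hn0 : 2 ≤ n 0) (j : ℕ) : rank (base (n j)) = n j + 1 :=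
  hbase _ (hn0.trans (hn.monotone (Nat.zero_le j)))

theorem exists_isSeqStar (a b : ℝ) {base : ℕ → Gam}
    (hbase : ∀ i, 2 ≤ i → rank (base i) = i + 1) {n : ℕ → ℕ} (hn : StrictMono n)
    (hn0 : 2 ≤ n 0) :
    ∃ (R : LOne →L[ℝ] LOne) (T : X a b ≃ₗᵢ[ℝ] X a b), IsSeqStar a b base n R ∧
      IsDualRestriction a b R (T.toContinuousLinearEquiv : X a b →L[ℝ] X a b) := by
  -- Since n_j ≥ j, every base used from step rank τ onwards has rank greater than rank τ.
  have hA : ∀ τ m, rank τ ≤ m → _ := fun τ m hm =>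
    SignedAut.seq_stable a b base n (τ := τ) (m₀ := rank τ) (fun j hj => by
      rw [rank_lt_rank_base hbase hn hn0]
      have := hn.le_apply (x := j)
      omega) hm
  refine ⟨_, _, fun x => ?_, (SignedAut.limit _ hA).isDualRestriction_onX⟩
  simp only [SignedAut.compStar_apply]
  exact SignedAut.tendsto_onLOne_limit _ hA x

theorem IsSeqStar.apply_eStar {a b : ℝ} {base : ℕ → Gam} {n : ℕ → ℕ} {R : LOne →L[ℝ] LOne}
    (hR : IsSeqStar a b base n R) {τ : Gam} {m₀ : ℕ}
    (h : ∀ j, m₀ ≤ j → rank τ < rank (base (n j))) :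
    R (eStar τ) = (SignedAut.seq a b base n m₀).onLOne (eStar τ) := by
  refine tendsto_nhds_unique (hR (eStar τ)) (tendsto_const_nhds.congr' ?_)
  filter_upwards [eventually_ge_atTop m₀] with m hm
  have hs := SignedAut.seq_stable a b base n h hm
  rw [SignedAut.compStar_apply, SignedAut.onLOne_eStar, SignedAut.onLOne_eStar, hs.1, hs.2]

/-! ### Bounds for the extensions by either choice of λ -/

theorem abs_unit_cast (e : ℤˣ) : |((e : ℤ) : ℝ)| = 1 := by
  rcases Int.units_eq_one_or e with rfl | rfl <;> simp

theorem abs_jMap_le {a b lam : ℝ} (ha : 0 ≤ a) (ha1 : a ≤ 1) (hb : 0 ≤ b) (hlam : 1 ≤ lam)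
    (h : a + 2 * b * lam ≤ lam) (k : ℕ) (x : GamLE k → ℝ) (hx : ∀ θ, |x θ| ≤ 1) (τ : Gam) :
    |jMap a b k x τ| ≤ lam := by
  obtain ⟨r, t⟩ := τ
  induction r using Nat.strong_induction_on generalizing k with
  | _ r ih =>
    by_cases hr : r ≤ k
    · rw [jMap_of_le a b (τ := ⟨r, t⟩) _ hr]
      exact (hx _).trans hlam
    have hk := not_le.1 hr
    cases t with
    | base =>
      rw [jMap_base_of_lt a b _ hk, abs_zero]
      linarith
    | @node n l p q hl hln hp hq ξ η ε ε' =>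
      rw [jMap_node _ _ _ _ _ _ _ _ _ _ _ hk]
      -- For k ≤ l the bracket vanishes and a ≤ 1 suffices. For l < k, ξ and Γ_l lie in Γ_k, where
      -- the values are at most 1, which gives a + 2bλ.
      rcases le_or_gt k l with hkl | hlk
      · rw [jMap_jMap_of_le a b hkl, sub_self, mul_zero, add_zero, abs_mul, abs_mul,
          abs_unit_cast, one_mul, abs_of_nonneg ha]
        have := ih p (by omega) k x hx ξ
        nlinarith [abs_nonneg (jMap a b k x ⟨p, ξ⟩)]
      · have h1 : |jMap a b k x ⟨p, ξ⟩| ≤ 1 := by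
          rw [jMap_of_le a b (τ := ⟨p, ξ⟩) x (hp.trans hlk.le)]
          exact hx _
        have h2 := ih q (by omega) k x hx η
        have h3 := ih q (by omega) l (fun δ => jMap a b k x δ.1) (fun δ => by
          rw [jMap_of_le a b x (δ.2.trans hlk.le)]
          exact hx _) η
        calc _ ≤ |((ε : ℤ) : ℝ) * a * jMap a b k x ⟨p, ξ⟩| + |((ε' : ℤ) : ℝ) * b *
              (jMap a b k x ⟨q, η⟩ - jMap a b l (fun δ => jMap a b k x δ.1) ⟨q, η⟩)| :=
              abs_add_le _ _
          _ ≤ a * 1 + b * (lam + lam) := by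
              simp only [abs_mul, abs_unit_cast, one_mul, abs_of_nonneg ha, abs_of_nonneg hb]
              exact add_le_add (mul_le_mul_of_nonneg_left h1 ha) (mul_le_mul_of_nonneg_left
                ((abs_sub _ _).trans (add_le_add h2 h3)) hb)
          _ ≤ lam := by linarith

theorem IsBDConstant.abs_jMap_le {a b lam : ℝ} (h : IsBDConstant a b lam) (k : ℕ)
    (x : GamLE k → ℝ) (hx : ∀ θ, |x θ| ≤ 1) (τ : Gam) : |jMap a b k x τ| ≤ lam := by
  rcases h with ⟨⟨hb, hb2, ha, ha1, hab⟩, rfl⟩ | ⟨⟨rfl, hb, hb2⟩, hlam, h⟩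
  · have hd : 0 < 1 - 2 * b := by linarith
    refine BD.abs_jMap_le (by linarith) ha1.le hb.le ?_ ?_ k x hx τ
    · rw [le_div_iff₀ hd]
      linarith
    · have : a / (1 - 2 * b) * (1 - 2 * b) = a := div_mul_cancel₀ _ hd.ne'
      linarith
  · exact BD.abs_jMap_le zero_le_one le_rfl hb.le hlam.le h k x hx τ

theorem exists_isBDConstant {a b : ℝ} (hab : ClassX a b ∨ ClassY a b) :
    ∃ lam, IsBDConstant a b lam := by
  rcases hab with h | h
  · refine ⟨1 / (1 - 2 * b), Or.inr ⟨h, ?_⟩⟩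
    obtain ⟨-, hb, hb2⟩ := h
    have hd : 0 < 1 - 2 * b := by linarith
    have : 1 / (1 - 2 * b) * (1 - 2 * b) = 1 := div_mul_cancel₀ _ hd.ne'
    refine ⟨?_, by linarith⟩
    rw [lt_div_iff₀ hd]
    linarith
  · exact ⟨_, Or.inl ⟨h, rfl⟩⟩

theorem memℓp_top_of_abs_le {f : Gam → ℝ} {C : ℝ} (h : ∀ τ, |f τ| ≤ C) :
    Memℓp (E := fun _ : Gam => ℝ) f ⊤ := by
  rw [memℓp_infty_iff]
  exact ⟨C, by rintro _ ⟨τ, rfl⟩; exact h τ⟩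

/-- f vanishes on every d^* of rank above k. So f(τ) depends only on the initial basis projection of
e_τ^*, of norm at most K, and there f may be replaced by x extended by zero. -/
theorem IsBasisConstant.abs_le {a b K : ℝ} (hK : IsBasisConstant a b K) {k : ℕ}
    {x : GamLE k → ℝ} (hx : ∀ θ, |x θ| ≤ 1) {f : LInf} (hf : (f : Gam → ℝ) = jMap a b k x)
    (τ : Gam) : |f τ| ≤ K := by
  obtain ⟨g, hg, hK, -⟩ := hK
  have hf' : ∀ τ, f τ = jMap a b k x τ := congrFun hf
  have hex : ∃ i, k < rank (g i) := by
    by_contra! hcon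
    have := finite_gamLE k
    exact not_injective_infinite_finite (fun i => (⟨g i, hcon i⟩ : GamLE k))
      fun i j hij => g.injective (congrArg Subtype.val hij)
  -- Monotonicity of rank along the enumeration makes Γ_k an initial segment, so restricting to rank
  -- at most k is a partial sum.
  obtain ⟨m, hm⟩ : ∃ m, ∀ i, i < m ↔ rank (g i) ≤ k :=
    ⟨Nat.find hex, fun i => ⟨fun hi => not_lt.1 (Nat.find_min hex hi), fun hi => by
      by_contra! hcon
      exact (hi.trans_lt (Nat.find_spec hex)).not_ge (hg hcon)⟩⟩
  have hspan : eStar τ ∈ Submodule.span ℝ (Set.range fun i => dStar a b (g i)) := by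
    have := eStar_mem_span_dStar a b τ
    rwa [← g.surjective.range_comp] at this
  obtain ⟨c, hc⟩ := Finsupp.mem_span_range_iff_exists_finsupp.1 hspan
  obtain ⟨N, hN⟩ := c.support.exists_nat_subset_range
  have hsum : eStar τ = ∑ i ∈ Finset.range (max m N), c i • dStar a b (g i) := by
    rw [← hc]
    exact Finsupp.sum_of_support_subset _ (hN.trans (Finset.range_subset_range.2 (le_max_right m N)))
      _ fun i _ => zero_smul _ _
  let z : Gam → ℝ := fun τ => if h : rank τ ≤ k then x ⟨τ, h⟩ else 0
  have hz : ∀ τ, |z τ| ≤ 1 := fun τ => by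
    simp only [z]
    split_ifs
    · exact hx _
    · simp
  let f₀ : LInf := ⟨z, memℓp_top_of_abs_le hz⟩
  have hf₀ : ∀ τ, f₀ τ = z τ := fun _ => rfl
  have hf₀n : ‖f₀‖ ≤ 1 := lp.norm_le_of_forall_le zero_le_one hz
  have hlow : ∀ i < m, pairingLin f (dStar a b (g i)) = pairingLin f₀ (dStar a b (g i)) := by
    intro i hi
    have hle := (hm i).1 hi
    have hff : ∀ θ, rank θ ≤ k → f θ = f₀ θ := fun θ h => by
      rw [hf', jMap_of_le a b x h, hf₀]
      simp only [z, dif_pos h]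
    rw [pairingLin_apply, pairingLin_apply, pairing_dStar, pairing_dStar, hff _ hle]
    congr 2
    funext θ
    exact hff _ (θ.2.trans ((Nat.sub_le _ _).trans hle))
  have hhigh : ∀ i, ¬ i < m → pairingLin f (dStar a b (g i)) = 0 := by
    intro i hi
    have hlt := not_le.1 (mt (hm i).2 hi)
    rw [pairingLin_apply, pairing_dStar]
    simp only [hf']
    rw [jMap_jMap_of_le a b (by omega), sub_self]
  have hpair : f τ = pairing f₀ (∑ i ∈ Finset.range m, c i • dStar a b (g i)) := by
    rw [← pairing_eStar, ← pairingLin_apply, ← pairingLin_apply, hsum, map_sum, map_sum]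
    refine (Finset.sum_subset (Finset.range_subset_range.2 (le_max_left m N))
      fun i _ hi => ?_).symm.trans (Finset.sum_congr rfl fun i hi => ?_)
    · rw [map_smul, hhigh i (by simpa using hi), smul_zero]
    · rw [map_smul, map_smul, hlow i (Finset.mem_range.1 hi)]
  have hKb := hK m (max m N) c (le_max_left _ _)
  rw [← hsum, norm_eStar, mul_one] at hKb
  rw [hpair]
  exact (abs_pairing_le _ _).trans ((mul_le_of_le_one_left (norm_nonneg _) hf₀n).trans hKb)

/-- A function in the image of `j_k` that is `1` on `Γ_k` and of norm at most `λ`. -/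
theorem exists_mem_X_norm_le {a b lam : ℝ} (hab : ClassX a b ∨ ClassY a b)
    (hlam : IsBDConstant a b lam ∨ IsBasisConstant a b lam) (k : ℕ) :
    ∃ f : X a b, (∀ τ, rank τ ≤ k → (f : LInf) τ = 1) ∧ ‖f‖ ≤ lam := by
  -- A constant of the construction is needed in either case, to know that the extension is bounded
  -- at all.
  obtain ⟨mu, hmu⟩ := exists_isBDConstant hab
  have hx : ∀ θ : GamLE k, |(fun _ => 1 : GamLE k → ℝ) θ| ≤ 1 := fun _ => abs_one.le
  let f : LInf := ⟨jMap a b k fun _ => 1, memℓp_top_of_abs_le (hmu.abs_jMap_le k _ hx)⟩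
  have hle : ∀ τ, |f τ| ≤ lam := by
    rcases hlam with h | h
    · exact h.abs_jMap_le k _ hx
    · exact h.abs_le hx rfl
  exact ⟨⟨f, Submodule.le_topologicalClosure _ (Submodule.subset_span ⟨k, _, rfl⟩)⟩,
    fun τ h => jMap_of_le a b _ h,
    lp.norm_le_of_forall_le ((abs_nonneg _).trans (hle ⟨1, Delta.base⟩)) hle⟩

/-! ### Separation of the limit operators -/

theorem IsDualRestriction.apply_eq {a b : ℝ} {R : LOne →L[ℝ] LOne} {T : X a b →L[ℝ] X a b}
    (h : IsDualRestriction a b R T) (f : X a b) (τ : Gam) :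
    (T f : LInf) τ = pairingLin (f : LInf) (R (eStar τ)) := by
  rw [← pairing_eStar]
  exact h f _

theorem le_norm_sub_of_lt {a b : ℝ} (hab : ClassX a b ∨ ClassY a b) {base : ℕ → Gam}
    (hbase : ∀ i, 2 ≤ i → rank (base i) = i + 1) {n n' : ℕ → ℕ} (hn : StrictMono n)
    (hn' : StrictMono n') (hn0 : 2 ≤ n 0) (hn0' : 2 ≤ n' 0) {i : ℕ}
    (heq : ∀ j < i, n j = n' j) (hlt : n i < n' i) {R R' : LOne →L[ℝ] LOne}
    {T T' : X a b →L[ℝ] X a b} (hR : IsSeqStar a b base n R) (hT : IsDualRestriction a b R T)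
    (hR' : IsSeqStar a b base n' R') (hT' : IsDualRestriction a b R' T') {lam : ℝ}
    (hlam : IsBDConstant a b lam ∨ IsBasisConstant a b lam) : 0 < lam ∧ 2 / lam ≤ ‖T - T'‖ := by
  obtain ⟨f, hf, hfn⟩ := exists_mem_X_norm_le hab hlam (n i + 1)
  set γ := base (n i) with hγ
  have hrγ : rank γ = n i + 1 := rank_lt_rank_base hbase hn hn0 i
  set A := SignedAut.seq a b base n i with hA
  -- The common first i factors carry e_τ^* to ± e_γ^*, exactly the vector on which the next factor
  -- of the first sequence flips the sign.
  set τ := A.equiv.symm γ with hτ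
  have hrτ : rank τ = n i + 1 := (A.rank_equiv_symm γ).trans hrγ
  have hAτ : A.onLOne (eStar τ) = A.sign τ • eStar γ := by
    rw [SignedAut.onLOne_eStar, hτ, Equiv.apply_symm_apply]
  have h1 : R (eStar τ) =
      A.sign τ • -eStar ((SignedAut.basic a b γ).equiv γ) := by
    rw [hR.apply_eStar (m₀ := i + 1) fun j hj => by
      rw [rank_lt_rank_base hbase hn hn0, hrτ]
      have := hn (show i < j by omega)
      omega]
    rw [SignedAut.seq, SignedAut.onLOne_trans, hAτ, map_smul, SignedAut.onLOne_eStar,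
      SignedAut.basic_self, neg_one_smul]
  -- From index i on, the bases of the second sequence have rank at least n'_i + 1 > rank τ and no
  -- longer act.
  have h2 : R' (eStar τ) = A.sign τ • eStar γ := by
    rw [hR'.apply_eStar (m₀ := i) fun j hj => by
      rw [rank_lt_rank_base hbase hn' hn0', hrτ]
      have := hn'.monotone hj
      omega]
    rw [← SignedAut.seq_congr a b base heq, hAτ]
  -- f equals 1 at both γ and its partner, so the opposite signs add up instead of cancelling.
  have hval : ((T - T') f : LInf) τ = -(2 * A.sign τ) := by
    have hsub : ((T - T') f : LInf) τ = (T f : LInf) τ - (T' f : LInf) τ := rfl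
    rw [hsub, hT.apply_eq, hT'.apply_eq, h1, h2, map_smul, map_smul, map_neg, pairingLin_apply,
      pairingLin_apply, pairing_eStar, pairing_eStar, hf γ hrγ.le,
      hf _ (((SignedAut.basic a b γ).rank_equiv γ).trans_le hrγ.le), smul_eq_mul, smul_eq_mul]
    ring
  have h2le : 2 ≤ ‖T - T'‖ * lam := by
    calc (2 : ℝ) = ‖((T - T') f : LInf) τ‖ := by
          rw [hval, norm_neg, norm_mul, Real.norm_eq_abs (A.sign τ), A.abs_sign]
          norm_num
      _ ≤ ‖(T - T') f‖ := lp.norm_apply_le_norm ENNReal.top_ne_zero _ τ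
      _ ≤ ‖T - T'‖ * ‖f‖ := ContinuousLinearMap.le_opNorm _ _
      _ ≤ ‖T - T'‖ * lam := mul_le_mul_of_nonneg_left hfn (T - T').opNorm_nonneg
  have hpos : 0 < lam := by
    have := (T - T').opNorm_nonneg
    by_contra! hneg
    have := mul_nonpos_of_nonneg_of_nonpos this hneg
    linarith
  exact ⟨hpos, (div_le_iff₀ hpos).2 h2le⟩

theorem le_norm_sub_of_ne {a b : ℝ} (hab : ClassX a b ∨ ClassY a b) {base : ℕ → Gam}
    (hbase : ∀ i, 2 ≤ i → rank (base i) = i + 1) {n n' : ℕ → ℕ} (hn : StrictMono n)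
    (hn' : StrictMono n') (hn0 : 2 ≤ n 0) (hn0' : 2 ≤ n' 0) (hne : n ≠ n')
    {R R' : LOne →L[ℝ] LOne} {T T' : X a b →L[ℝ] X a b} (hR : IsSeqStar a b base n R)
    (hT : IsDualRestriction a b R T) (hR' : IsSeqStar a b base n' R')
    (hT' : IsDualRestriction a b R' T') {lam : ℝ}
    (hlam : IsBDConstant a b lam ∨ IsBasisConstant a b lam) :
    0 < lam ∧ 2 / lam ≤ ‖T - T'‖ := by
  have hex := Function.ne_iff.1 hne
  have heq : ∀ j < Nat.find hex, n j = n' j := fun j hj => not_not.1 (Nat.find_min hex hj)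
  rcases lt_or_gt_of_ne (Nat.find_spec hex) with h | h
  · exact le_norm_sub_of_lt hab hbase hn hn' hn0 hn0' heq h hR hT hR' hT' hlam
  · have hrev : ‖T - T'‖ = ‖T' - T‖ := norm_sub_rev T T'
    rw [hrev]
    exact le_norm_sub_of_lt hab hbase hn' hn hn0' hn0 (fun j hj => (heq j hj).symm) h hR' hT' hR
      hT hlam

/-! ### Uncountably many sequences and non-separability -/

theorem not_countable_strictMono {p q : ℕ} (hpq : p < q) :
    ¬ {n : ℕ → ℕ | StrictMono n ∧ n 0 = p ∧ n 1 = q}.Countable := by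
  classical
  intro h
  -- Subsets of ℕ are coded by one binary choice per later term; the spacing 2j keeps the sequence
  -- strictly increasing.
  let g : Set ℕ → ℕ → ℕ := fun s j => match j with
    | 0 => p
    | 1 => q
    | j + 2 => q + 2 * j + 1 + if j ∈ s then 1 else 0
  have hg : Function.Injective g := by
    intro s t hst
    ext j
    have := congrFun hst (j + 2)
    simp only [g] at this
    by_cases hs : j ∈ s <;> by_cases ht : j ∈ t <;> simp_all
  have hmem : ∀ s, g s ∈ {n : ℕ → ℕ | StrictMono n ∧ n 0 = p ∧ n 1 = q} := by
    refine fun s => ⟨strictMono_nat_of_lt_succ fun j => ?_, rfl, rfl⟩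
    match j with
    | 0 => exact hpq
    | 1 => simp only [g]; omega
    | j + 2 => simp only [g]; split_ifs <;> omega
  have hu : (Set.univ : Set (Set ℕ)).Countable :=
    (h.preimage_of_injOn (f := g) hg.injOn).mono fun s _ => hmem s
  obtain ⟨f, hf⟩ := Set.countable_univ_iff.1 hu
  exact Function.cantor_injective f hf

theorem not_separableSpace {a b : ℝ} (hab : ClassX a b ∨ ClassY a b) {base : ℕ → Gam}
    (hbase : ∀ i, 2 ≤ i → rank (base i) = i + 1) :
    ¬ TopologicalSpace.SeparableSpace (X a b →L[ℝ] X a b) := by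
  intro hsep
  obtain ⟨lam, hlam⟩ := exists_isBDConstant hab
  have hex : ∀ n : {n : ℕ → ℕ // StrictMono n ∧ n 0 = 2 ∧ n 1 = 3},
      ∃ (R : LOne →L[ℝ] LOne) (T : X a b →L[ℝ] X a b), IsSeqStar a b base n R ∧
        IsDualRestriction a b R T := fun n =>
    let ⟨R, T, h⟩ := exists_isSeqStar a b hbase n.2.1 n.2.2.1.ge
    ⟨R, _, h⟩
  choose R T hR hT using hex
  have hlower : ∀ n n', n ≠ n' → 0 < lam ∧ 2 / lam ≤ ‖T n - T n'‖ := fun n n' hne =>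
    le_norm_sub_of_ne hab hbase n.2.1 n'.2.1 n.2.2.1.ge n'.2.2.1.ge (Subtype.coe_injective.ne hne)
      (hR n) (hT n) (hR n') (hT n') (Or.inl hlam)
  have hpos : 0 < lam := one_pos.trans_le (by
      simpa [jMap, rank] using hlam.abs_jMap_le 1 (fun _ => 1) (by simp) ⟨1, Delta.base⟩)
  refine not_countable_strictMono (p := 2) (q := 3) (by norm_num) ?_
  -- Centres are at least 2/λ apart, so balls of radius 1/λ are disjoint; a separable space admits
  -- only countably many disjoint nonempty open sets.
  have hdisj : (Set.univ : Set {n : ℕ → ℕ // StrictMono n ∧ n 0 = 2 ∧ n 1 = 3}).PairwiseDisjoint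
      fun n => Metric.ball (T n) (1 / lam) := by
    intro n _ n' _ hne
    refine Metric.ball_disjoint_ball ?_
    have hd : dist (T n) (T n') = ‖T n - T n'‖ :=
      @dist_eq_norm _ ContinuousLinearMap.toSeminormedAddCommGroup (T n) (T n')
    rw [hd, ← add_div, one_add_one_eq_two]
    exact (hlower n n' hne).2
  have := hdisj.countable_of_isOpen (fun _ _ => Metric.isOpen_ball)
    fun n _ => Metric.nonempty_ball.2 (one_div_pos.2 hpos)
  exact Set.countable_coe_iff.1 (Set.countable_univ_iff.1 this)

end BD

theorem mainTheorem4 (a b : ℝ) (hab : BD.ClassX a b ∨ BD.ClassY a b)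
    (base : ℕ → BD.Gam) (hbase : ∀ i, 2 ≤ i → BD.rank (base i) = i + 1) :
    -- the basic operators with the given bases are well defined
    (∀ i, 2 ≤ i → BD.IsBasicStar a b (base i) (BD.basicStar a b (base i)) ∧
      ∀ S, BD.IsBasicStar a b (base i) S → S = BD.basicStar a b (base i)) ∧
    -- the limit operators exist, and their duals restrict to onto isometries of `X`
    (∀ n : ℕ → ℕ, StrictMono n → 2 ≤ n 0 →
      ∃ (R : BD.LOne →L[ℝ] BD.LOne) (T : BD.X a b ≃ₗᵢ[ℝ] BD.X a b),
        BD.IsSeqStar a b base n R ∧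
        BD.IsDualRestriction a b R (T.toContinuousLinearEquiv : BD.X a b →L[ℝ] BD.X a b)) ∧
    -- operators of different sequences with the same first two terms are far apart
    (∀ n n' : ℕ → ℕ, StrictMono n → StrictMono n' → 2 ≤ n 0 → n 0 = n' 0 → n 1 = n' 1 → n ≠ n' →
      ∀ (R R' : BD.LOne →L[ℝ] BD.LOne) (T T' : BD.X a b →L[ℝ] BD.X a b),
        BD.IsSeqStar a b base n R → BD.IsDualRestriction a b R T →
        BD.IsSeqStar a b base n' R' → BD.IsDualRestriction a b R' T' →
        ∀ lam : ℝ, (BD.IsBDConstant a b lam ∨ BD.IsBasisConstant a b lam) →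
          1 / (2 * lam) ≤ ‖T - T'‖) ∧
    -- there are uncountably many such sequences
    (∀ p q : ℕ, 2 ≤ p → p < q →
      ¬ {n : ℕ → ℕ | StrictMono n ∧ n 0 = p ∧ n 1 = q}.Countable) ∧
    ¬ TopologicalSpace.SeparableSpace (BD.X a b →L[ℝ] BD.X a b) := by
  refine ⟨fun i _ => ⟨BD.isBasicStar_basicStar a b _, fun S hS =>
      hS.eq (BD.isBasicStar_basicStar a b _)⟩,
    fun n hn hn0 => BD.exists_isSeqStar a b hbase hn hn0, ?_,
    fun p q _ hpq => BD.not_countable_strictMono hpq, BD.not_separableSpace hab hbase⟩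
  intro n n' hn hn' hn0 h0 _ hne R R' T T' hR hT hR' hT' lam hlam
  obtain ⟨hpos, hle⟩ :=
    BD.le_norm_sub_of_ne hab hbase hn hn' hn0 (h0 ▸ hn0) hne hR hT hR' hT' hlam
  refine le_trans ?_ hle
  rw [div_le_div_iff₀ (by positivity) hpos]
  linarith
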